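/- An $r$-graph $H$ is a set of vertices together with a set of edges, each of which is an $r$-element subset of the vertex set. It is linear if any two distinct edges share at most one vertex. For $k\ge 3$, a linear cycle of length $k$ in $H$ consists of edges $e_1,\dots,e_k$ of $H$ such that cyclically consecutive edges share exactly one vertex, these $k$ shared vertices are distinct, and any two non-consecutive edges are disjoint. The girth of $H$ is the smallest $k$ such that $H$ contains a linear cycle of length $k$ (and $\infty$ if there is none). Let $\mathrm{Forb}_L(n,r,\ell)$ be the set of all linear $r$-graphs with vertex set $[n]=\{1,\dots,n\}$ and girth larger than $\ell$. Theorem. For all integers $r\ge 3$ and $\ell\ge 4$ there exists a constant $C=C(r,\ell)>0$ such that, for every $n$, $$|\mathrm{Forb}_L(n,r,\ell)|\le 2^{Cn^{1+1/\lfloor \ell/2\rfloor}}.$$ Equivalently, for all integers $r\ge 3$ and $\ell\ge 2$ there exists a constant $C=C(r,\ell)>0$ such that, for every $n$, $$|\mathrm{Forb}_L(n,r,2\ell)|\le 2^{Cn^{1+1/\ell}}.$$ -/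

import Mathlib

open scoped Hypergraph

namespace Hypergraph

variable {α : Type*}

/-- An `r`-uniform hypergraph (`r`-graph): every edge is a set of exactly `r` vertices. -/
def IsUniform (H : Hypergraph α) (r : ℕ) : Prop :=
  ∀ e ∈ E(H), e.encard = r

/-- A linear hypergraph: any two distinct edges share at most one vertex. -/
def IsLinear (H : Hypergraph α) : Prop :=
  ∀ e ∈ E(H), ∀ f ∈ E(H), e ≠ f → (e ∩ f).encard ≤ 1

/-- The sets `e i`, indexed cyclically by `ZMod k`, form a linear cycle of length `k ≥ 3`:
cyclically consecutive sets share exactly one vertex, and non-consecutive ones are disjoint.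
The shared vertices `v i` are required to be distinct. This is automatic for `k ≥ 4`, because
non-consecutive sets are disjoint; for `k = 3` it excludes three sets through a common vertex. -/
def IsLinearCycle (k : ℕ) (e : ZMod k → Set α) : Prop :=
  3 ≤ k ∧
  (∃ v : ZMod k → α, Function.Injective v ∧ ∀ i, e i ∩ e (i + 1) = {v i}) ∧
  ∀ i j, i ≠ j → j ≠ i + 1 → i ≠ j + 1 → Disjoint (e i) (e j)

/-- `H` contains a linear cycle of length `k` as a subgraph. If `H` is `r`-uniform, so is the
cycle. -/
def ContainsLinearCycle (H : Hypergraph α) (k : ℕ) : Prop :=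
  ∃ e : ZMod k → Set α, IsLinearCycle k e ∧ ∀ i, e i ∈ E(H)

/-- The girth of `H`: the smallest `k` such that `H` contains a linear cycle of length `k`;
it is `⊤` if `H` contains no linear cycle. -/
noncomputable def girth (H : Hypergraph α) : ℕ∞ :=
  ⨅ (k : ℕ) (_ : H.ContainsLinearCycle k), (k : ℕ∞)

/-- The set of linear `r`-graphs with vertex set `[n]` and girth larger than `l`. -/
def forbLinear (n r l : ℕ) : Set (Hypergraph (Fin n)) :=
  {H | V(H) = Set.univ ∧ H.IsUniform r ∧ H.IsLinear ∧ (l : ℕ∞) < H.girth}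

/-- There are finitely many hypergraphs on a finite vertex type, so `Set.ncard` below counts. -/
instance instFiniteHypergraph [Finite α] : Finite (Hypergraph α) :=
  Finite.of_injective (fun H : Hypergraph α => (H.vertexSet, H.edgeSet)) fun _ _ h =>
    Hypergraph.ext (congrArg Prod.fst h) (congrArg Prod.snd h)

end Hypergraph

/-! The problem reduces to counting graphs of girth above `2 * l`.

Reduction: order every `r`-set and, for each pair of positions, keep from each hyperedge only the
two vertices there. A cycle in such a pair graph is a Berge cycle, which linearity shortens to a
linear cycle, so pair graphs inherit the girth (`lt_egirth_pairGraph`). Without linear triangles,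
they determine the hypergraph (`mem_edgeSet_iff_forall_pairGraph_adj`).

Graphs: delete a vertex `v` of minimum degree `d` and put `m = l - 1`. The neighbours of `v` are
pairwise at distance above `2 * m` in `G - v` (`not_closeBy_of_adj`). The remaining degrees are at
least `d - 1`, so paths of length `m` reach about `d ^ m` vertices from each start, with small
overlaps (`card_pathEnds_inter_le`). By Cauchy–Schwarz, closeness is then dense on every set much
larger than `n / d ^ m` (`exists_many_closeBy`). The Kleitman–Winston algorithm leaves `exp (O (n ^
(1 / l)))` choices for the neighbourhood of `v`, and at most `n` deletions give the theorem for
graphs. -/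

namespace SimpleGraph

/-! ### Uniqueness of short paths -/

variable {V : Type*} {G : SimpleGraph V}

/-- In a graph of large girth, short paths are determined by their endpoints. -/
theorem Walk.IsPath.eq_of_lt_egirth {u v : V} {p q : G.Walk u v} (hp : p.IsPath) (hq : q.IsPath)
    (h : ((p.length + q.length : ℕ) : ℕ∞) < G.egirth) : p = q := by
  classical
  by_contra hne
  -- The union of the two paths is not a forest, since paths in forests are unique; a cycle in it
  -- has at most `p.length + q.length` edges.
  let K : SimpleGraph V := fromEdgeSet {e | e ∈ p.edges ∨ e ∈ q.edges}
  have hK : ∀ e ∈ K.edgeSet, e ∈ p.edges ∨ e ∈ q.edges := by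
    intro e he
    simp only [K, edgeSet_fromEdgeSet] at he
    exact he.1
  have hpK : ∀ e ∈ p.edges, e ∈ K.edgeSet := by
    intro e he
    simp only [K, edgeSet_fromEdgeSet]
    exact ⟨Or.inl he, G.not_isDiag_of_mem_edgeSet (p.edges_subset_edgeSet he)⟩
  have hqK : ∀ e ∈ q.edges, e ∈ K.edgeSet := by
    intro e he
    simp only [K, edgeSet_fromEdgeSet]
    exact ⟨Or.inr he, G.not_isDiag_of_mem_edgeSet (q.edges_subset_edgeSet he)⟩
  have hKG : K ≤ G := by
    rw [← edgeSet_subset_edgeSet]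
    intro e he
    rcases hK e he with h' | h'
    · exact p.edges_subset_edgeSet h'
    · exact q.edges_subset_edgeSet h'
  have hcyc : ¬ K.IsAcyclic := by
    intro hac
    have := hac.subsingleton_path u v
    have h2 : p.transfer K hpK = q.transfer K hqK := congrArg Subtype.val
      (Subsingleton.elim (⟨_, hp.transfer hpK⟩ : K.Path u v) ⟨_, hq.transfer hqK⟩)
    have h3 := congrArg Walk.support h2
    simp only [Walk.support_transfer] at h3
    exact hne (Walk.ext_support h3)
  simp only [IsAcyclic, not_forall, not_not] at hcyc
  obtain ⟨a, c, hc⟩ := hcyc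
  have h1 : c.length ≤ p.length + q.length := by
    rw [← c.length_edges, ← List.toFinset_card_of_nodup hc.isTrail.edges_nodup]
    calc c.edges.toFinset.card ≤ (p.edges ++ q.edges).toFinset.card := by
          apply Finset.card_le_card
          intro e he
          simp only [List.mem_toFinset, List.mem_append] at he ⊢
          exact hK e (c.edges_subset_edgeSet he)
      _ ≤ (p.edges ++ q.edges).length := List.toFinset_card_le _
      _ = _ := by simp
  have h2 := egirth_le_length (hc.mapLe hKG)
  simp only [Walk.length_map] at h2
  exact absurd (h.trans_le h2) (not_lt.2 (by exact_mod_cast h1))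

/-- If `w` is the end of some path from `u` of length `j + 1`, and `p` is a path of length `j` from
`u` to a neighbour of `w`, then `w` is not on `p`. -/
theorem Walk.IsPath.notMem_support_of_lt_egirth {u x w : V} {j : ℕ} {p : G.Walk u x}
    {q : G.Walk u w} (hp : p.IsPath) (hpl : p.length = j) (hq : q.IsPath) (hql : q.length = j + 1)
    (hg : ((2 * j + 1 : ℕ) : ℕ∞) < G.egirth) : w ∉ p.support := by
  classical
  intro hw
  have hle := p.length_takeUntil_le_length hw
  have := (hp.takeUntil hw).eq_of_lt_egirth hq (lt_of_le_of_lt (by norm_cast; omega) hg)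
  rw [← this] at hql
  omega

/-- A vertex of a short path adjacent to its end is the penultimate one. -/
theorem Walk.IsPath.eq_getVert_of_adj_of_lt_egirth {u x w : V} {j : ℕ} {p : G.Walk u x}
    (hp : p.IsPath) (hpl : p.length = j) (h : G.Adj x w) (hw : w ∈ p.support)
    (hg : ((j + 1 : ℕ) : ℕ∞) < G.egirth) : w = p.getVert (j - 1) := by
  classical
  have hsum := congrArg Walk.length (p.take_spec hw)
  rw [Walk.length_append] at hsum
  have h1 : (Walk.cons h.symm Walk.nil).IsPath := by simp [h.ne']
  have h2 := (hp.dropUntil hw).eq_of_lt_egirth h1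
    (lt_of_le_of_lt (by simp only [Walk.length_cons, Walk.length_nil]; norm_cast; omega) hg)
  have h3 : (p.dropUntil w hw).length = 1 := by rw [h2]; simp
  have h4 : j - 1 = (p.takeUntil w hw).length := by omega
  rw [h4, Walk.getVert_length_takeUntil]

/-! ### Growth and overlap of path ends -/

open Classical in
/-- The ends of the paths of length `j` from `u` whose steps go from a vertex `x` to a member of
`A x`. -/
noncomputable def pathEnds (G : SimpleGraph V) (A : V → Finset V) (u : V) : ℕ → Finset V
  | 0 => {u}
  | j + 1 => ((pathEnds G A u j).biUnion A).filter fun w =>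
      ∃ p : G.Walk u w, p.IsPath ∧ p.length = j + 1

variable {A : V → Finset V} {u u' w : V} {j : ℕ}

theorem pathEnds_zero : G.pathEnds A u 0 = {u} := by rw [pathEnds]

theorem mem_pathEnds_succ : w ∈ G.pathEnds A u (j + 1) ↔
    (∃ x ∈ G.pathEnds A u j, w ∈ A x) ∧ ∃ p : G.Walk u w, p.IsPath ∧ p.length = j + 1 := by
  classical
  rw [pathEnds]
  simp

theorem exists_isPath_of_mem_pathEnds (h : w ∈ G.pathEnds A u j) :
    ∃ p : G.Walk u w, p.IsPath ∧ p.length = j := by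
  cases j with
  | zero =>
    rw [pathEnds_zero, Finset.mem_singleton] at h
    subst h
    exact ⟨Walk.nil, by simp, rfl⟩
  | succ j => exact (mem_pathEnds_succ.1 h).2

theorem pathEnds_subset {U : Finset V} (hU : ∀ x ∈ U, A x ⊆ U) (hu : u ∈ U) :
    G.pathEnds A u j ⊆ U := by
  induction j with
  | zero => simpa [pathEnds_zero] using hu
  | succ j ih =>
    intro w hw
    obtain ⟨⟨x, hx, hwx⟩, -⟩ := mem_pathEnds_succ.1 hw
    exact hU x (ih hx) hwx

/-- A path to a member of `pathEnds`, split at its last step. -/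
theorem exists_isPath_concat (hA : ∀ x, ∀ w ∈ A x, G.Adj x w)
    (hg : ((2 * j + 1 : ℕ) : ℕ∞) < G.egirth) {x : V} (hx : x ∈ G.pathEnds A u j) (hwx : w ∈ A x)
    (hw : w ∈ G.pathEnds A u (j + 1)) :
    ∃ p : G.Walk u x, p.length = j ∧ (p.concat (hA x w hwx)).IsPath := by
  obtain ⟨p, hp, hpl⟩ := exists_isPath_of_mem_pathEnds hx
  obtain ⟨q, hq, hql⟩ := exists_isPath_of_mem_pathEnds hw
  exact ⟨p, hpl, hp.concat (hp.notMem_support_of_lt_egirth hpl hq hql hg) _⟩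

/-- Two parents of one end would give two short paths between the same vertices, so the children of
different vertices are disjoint. Each vertex loses at most one of its `D` chosen neighbours, the one
its path came from. -/
theorem pow_le_card_pathEnds {U : Finset V} {D m : ℕ} (hA : ∀ x, ∀ w ∈ A x, G.Adj x w)
    (hU : ∀ x ∈ U, A x ⊆ U) (hD : ∀ x ∈ U, (A x).card = D)
    (hg : ((2 * m : ℕ) : ℕ∞) < G.egirth) (hu : u ∈ U) (hj : j ≤ m) :
    (D - 1) ^ j ≤ (G.pathEnds A u j).card := by
  classical
  induction j with
  | zero => simp [pathEnds_zero]
  | succ j ih =>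
    have hg' : ((2 * j + 1 : ℕ) : ℕ∞) < G.egirth :=
      lt_of_le_of_lt (by norm_cast; omega) hg
    let F : V → Finset V := fun x => (A x).filter (· ∈ G.pathEnds A u (j + 1))
    have hdisj : ((G.pathEnds A u j : Finset V) : Set V).PairwiseDisjoint F := by
      intro x hx x' hx' hne
      rw [Function.onFun, Finset.disjoint_left]
      intro w hw hw'
      simp only [F, Finset.mem_filter] at hw hw'
      obtain ⟨p, hpl, hp⟩ := exists_isPath_concat hA hg' hx hw.1 hw.2
      obtain ⟨p', hpl', hp'⟩ := exists_isPath_concat hA hg' hx' hw'.1 hw.2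
      have := hp.eq_of_lt_egirth hp' (lt_of_le_of_lt
        (by simp only [Walk.length_concat]; norm_cast; omega) hg)
      exact hne (Walk.concat_inj this).1
    have hcard : ∀ x ∈ G.pathEnds A u j, D - 1 ≤ (F x).card := by
      intro x hx
      obtain ⟨p, hp, hpl⟩ := exists_isPath_of_mem_pathEnds hx
      have hsub : (A x).erase (p.getVert (j - 1)) ⊆ F x := by
        intro w hw
        rw [Finset.mem_erase] at hw
        refine Finset.mem_filter.2 ⟨hw.2, mem_pathEnds_succ.2 ⟨⟨x, hx, hw.2⟩, ?_⟩⟩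
        refine ⟨p.concat (hA x w hw.2), hp.concat (fun hmem => hw.1 ?_) _, by simp [hpl]⟩
        exact hp.eq_getVert_of_adj_of_lt_egirth hpl (hA x w hw.2) hmem
          (lt_of_le_of_lt (by norm_cast; omega) hg')
      calc D - 1 = (A x).card - 1 := by rw [hD x (pathEnds_subset hU hu hx)]
        _ ≤ ((A x).erase (p.getVert (j - 1))).card := Finset.pred_card_le_card_erase
        _ ≤ _ := Finset.card_le_card hsub
    calc (D - 1) ^ (j + 1) = (D - 1) ^ j * (D - 1) := pow_succ _ _
      _ ≤ (G.pathEnds A u j).card * (D - 1) := Nat.mul_le_mul_right _ (ih (by omega))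
      _ ≤ ∑ x ∈ G.pathEnds A u j, (F x).card := by
          rw [← smul_eq_mul]; exact Finset.card_nsmul_le_sum _ _ _ hcard
      _ = ((G.pathEnds A u j).biUnion F).card := (Finset.card_biUnion hdisj).symm
      _ ≤ _ := by
          apply Finset.card_le_card
          intro w hw
          simp only [F, Finset.mem_biUnion, Finset.mem_filter] at hw
          obtain ⟨_, _, _, h⟩ := hw
          exact h

theorem card_pathEnds_le {D : ℕ} (hD : ∀ x, (A x).card ≤ D) : (G.pathEnds A u j).card ≤ D ^ j := by
  classical
  induction j with
  | zero => simp [pathEnds_zero]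
  | succ j ih =>
    rw [pathEnds]
    calc _ ≤ ((G.pathEnds A u j).biUnion A).card := Finset.card_filter_le _ _
      _ ≤ (G.pathEnds A u j).card * D := Finset.card_biUnion_le_card_mul _ _ _ fun x _ => hD x
      _ ≤ D ^ j * D := Nat.mul_le_mul_right _ ih
      _ = _ := (pow_succ _ _).symm

/-- If `x` is not reached from `u` in `j` steps, but a neighbour `w` of `x` is reached in `j + 1`
steps, then some path from `u` to `x` of length `j + 2` ends with `w, x`. -/
theorem exists_isPath_concat_of_notMem (hA : ∀ x, ∀ w ∈ A x, G.Adj x w)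
    (hg : ((2 * (j + 2) : ℕ) : ℕ∞) < G.egirth) {x : V} (hx : x ∉ G.pathEnds A u j)
    (hwx : G.Adj w x) (hw : w ∈ G.pathEnds A u (j + 1)) :
    ∃ p : G.Walk u w, p.length = j + 1 ∧ (p.concat hwx).IsPath := by
  classical
  obtain ⟨⟨x₀, hx₀, hwx₀⟩, -⟩ := mem_pathEnds_succ.1 hw
  obtain ⟨p, hpl, hp⟩ := exists_isPath_concat hA
    (lt_of_le_of_lt (by norm_cast; omega) hg) hx₀ hwx₀ hw
  refine ⟨p.concat (hA x₀ w hwx₀), by simp [hpl], hp.concat (fun hmem => ?_) _⟩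
  have hxp : x ∈ p.support := by
    rw [Walk.support_concat] at hmem
    simpa [hwx.ne'] using hmem
  obtain ⟨h1, h2⟩ := (Walk.concat_isPath_iff _).1 hp
  have h3 : ((p.dropUntil x hxp).concat (hA x₀ w hwx₀)).IsPath :=
    (h1.dropUntil hxp).concat (fun h => h2 (p.support_dropUntil_subset_support hxp h)) _
  have h4 : ((Walk.nil : G.Walk x x).concat hwx.symm).IsPath :=
    (Walk.concat_isPath_iff _).2 ⟨by simp, by simpa using hwx.ne⟩
  have hl := p.length_dropUntil_le_length hxp
  have := (Walk.concat_inj (h3.eq_of_lt_egirth h4 (lt_of_le_of_lt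
    (by simp only [Walk.length_concat, Walk.length_nil]; norm_cast; omega) hg))).1
  exact hx (this ▸ hx₀)

-- Induction on `j`: the last step from `u'` to a common end starts either at a common end of level
-- `j`, with at most `D` continuations, or at a vertex not reached from `u`, with at most one.
open Classical in
theorem card_pathEnds_inter_le {D m : ℕ} (hA : ∀ x, ∀ w ∈ A x, G.Adj x w)
    (hD : ∀ x, (A x).card ≤ D)
    (hg : ((2 * (m + 1) : ℕ) : ℕ∞) < G.egirth) (hne : u ≠ u') (hj : j ≤ m) :
    (G.pathEnds A u j ∩ G.pathEnds A u' j).card ≤ j * D ^ (j - 1) := by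
  induction j with
  | zero => simp [pathEnds_zero, hne]
  | succ j ih =>
    have hg' : ((2 * (j + 2) : ℕ) : ℕ∞) < G.egirth := lt_of_le_of_lt (by norm_cast; omega) hg
    let I := G.pathEnds A u j ∩ G.pathEnds A u' j
    let N : V → Finset V := fun x => (A x).filter (· ∈ G.pathEnds A u (j + 1))
    -- Members of `N x` are penultimate vertices of paths of length `j + 2` from `u` to `x`, and
    -- such a path is unique.
    have hE : ∀ x ∈ G.pathEnds A u' j \ G.pathEnds A u j, (N x).card ≤ 1 := by
      intro x hx
      rw [Finset.mem_sdiff] at hx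
      rw [Finset.card_le_one]
      intro a ha b hb
      simp only [N, Finset.mem_filter] at ha hb
      obtain ⟨p, hpl, hp⟩ := exists_isPath_concat_of_notMem hA hg' hx.2 (hA x a ha.1).symm ha.2
      obtain ⟨q, hql, hq⟩ := exists_isPath_concat_of_notMem hA hg' hx.2 (hA x b hb.1).symm hb.2
      exact (Walk.concat_inj (hp.eq_of_lt_egirth hq (lt_of_le_of_lt
        (by simp only [Walk.length_concat]; norm_cast; omega) hg'))).1
    have h1 : (I.biUnion A).card ≤ (j * D ^ (j - 1)) * D :=
      (Finset.card_biUnion_le_card_mul _ _ _ fun x _ => hD x).trans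
        (Nat.mul_le_mul_right _ (ih (by omega)))
    have h2 : ((G.pathEnds A u' j \ G.pathEnds A u j).biUnion N).card ≤ D ^ j * 1 :=
      (Finset.card_biUnion_le_card_mul _ _ _ hE).trans (Nat.mul_le_mul_right _
        ((Finset.card_le_card Finset.sdiff_subset).trans (card_pathEnds_le hD)))
    calc (G.pathEnds A u (j + 1) ∩ G.pathEnds A u' (j + 1)).card
        ≤ ((G.pathEnds A u' j \ G.pathEnds A u j).biUnion N ∪ I.biUnion A).card :=
          Finset.card_le_card (by
          intro w hw
          rw [Finset.mem_inter] at hw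
          obtain ⟨⟨x, hx, hwx⟩, -⟩ := mem_pathEnds_succ.1 hw.2
          rw [Finset.mem_union, Finset.mem_biUnion, Finset.mem_biUnion]
          by_cases h : x ∈ G.pathEnds A u j
          · exact Or.inr ⟨x, Finset.mem_inter.2 ⟨h, hx⟩, hwx⟩
          · exact Or.inl ⟨x, Finset.mem_sdiff.2 ⟨hx, h⟩, Finset.mem_filter.2 ⟨hwx, hw.1⟩⟩)
      _ ≤ D ^ j * 1 + (j * D ^ (j - 1)) * D :=
          (Finset.card_union_le _ _).trans (Nat.add_le_add h2 h1)
      _ = D ^ j + j * D ^ j := by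
          rcases j with _ | j
          · simp
          · simp [pow_succ, mul_assoc]
      _ = (j + 1) * D ^ (j + 1 - 1) := by simp; ring

end SimpleGraph

/-! ### Supersaturation of close pairs -/

namespace SimpleGraph

variable {V : Type*} {G : SimpleGraph V}

/-- Vertices that are joined by a walk of length at most `k`. -/
def CloseBy (G : SimpleGraph V) (k : ℕ) (u v : V) : Prop :=
  u ≠ v ∧ ∃ p : G.Walk u v, p.length ≤ k

open Classical in
/-- Supersaturation: in a graph of girth larger than `2 * (m + 1)`, every large set of vertices
contains one that is close to many others. -/
theorem exists_many_closeBy [Fintype V] {A : V → Finset V} {U S : Finset V} {D m : ℕ}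
    (hA : ∀ x, ∀ w ∈ A x, G.Adj x w) (hU : ∀ x ∈ U, A x ⊆ U) (hD : ∀ x ∈ U, (A x).card = D)
    (hD' : ∀ x, (A x).card ≤ D) (hg : ((2 * (m + 1) : ℕ) : ℕ∞) < G.egirth) (hSU : S ⊆ U)
    (hne : S.Nonempty) (hS : 2 * Fintype.card V ≤ S.card * (D - 1) ^ m) :
    ∃ u ∈ S, S.card * (D - 1) ^ (2 * m) ≤ 2 * Fintype.card V * (m * D ^ (m - 1)) *
      (S.filter (G.CloseBy (2 * m) u)).card := by
  by_contra! hcon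
  set n := Fintype.card V
  let B : V → Finset V := fun u => G.pathEnds A u m
  let I : ℕ := m * D ^ (m - 1)
  have hsmall : 2 * n * I * ∑ u ∈ S, (S.filter (G.CloseBy (2 * m) u)).card <
      S.card * (S.card * (D - 1) ^ (2 * m)) := by
    rw [Finset.mul_sum, ← smul_eq_mul (a := S.card), ← Finset.sum_const]
    exact Finset.sum_lt_sum_of_nonempty hne hcon
  have hX : S.card * (D - 1) ^ m ≤ ∑ u ∈ S, (B u).card := by
    rw [← smul_eq_mul]
    refine Finset.card_nsmul_le_sum _ _ _ fun u hu => ?_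
    exact pow_le_card_pathEnds hA hU hD (lt_of_le_of_lt (by norm_cast; omega) hg) (hSU hu) le_rfl
  set X := ∑ u ∈ S, (B u).card with hXdef
  -- `f w` counts the sets `B u` containing `w`; its second moment counts overlaps.
  let f : V → ℕ := fun w => ∑ u ∈ S, if w ∈ B u then 1 else 0
  have hXf : X = ∑ w, f w := by
    simp only [f]
    rw [Finset.sum_comm]
    simp [hXdef]
  have hf2 : ∑ w, f w ^ 2 = ∑ u ∈ S, ∑ u' ∈ S, (B u ∩ B u').card := by
    simp only [f, sq, Finset.sum_mul_sum]
    rw [Finset.sum_comm]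
    refine Finset.sum_congr rfl fun u _ => ?_
    rw [Finset.sum_comm]
    refine Finset.sum_congr rfl fun u' _ => ?_
    rw [Finset.card_eq_sum_ones, ← Finset.sum_filter_add_sum_filter_not Finset.univ
      (· ∈ B u ∩ B u'), Finset.filter_univ_mem]
    rw [Finset.sum_eq_zero (s := Finset.univ.filter (· ∉ B u ∩ B u')), add_zero]
    · refine Finset.sum_congr rfl fun w hw => ?_
      rw [Finset.mem_inter] at hw
      simp [hw.1, hw.2]
    · intro w hw
      simp only [Finset.mem_filter, Finset.mem_inter, not_and] at hw
      by_cases h : w ∈ B u <;> simp_all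
  have hCS : X ^ 2 ≤ n * ∑ w, f w ^ 2 := by
    rw [hXf]
    simpa [n] using sq_sum_le_card_mul_sum_sq (s := Finset.univ) (f := f)
  have hrow : ∀ u ∈ S, ∑ u' ∈ S, (B u ∩ B u').card ≤
      (B u).card + (S.filter (G.CloseBy (2 * m) u)).card * I := by
    intro u hu
    rw [← Finset.add_sum_erase _ _ hu, Finset.inter_self]
    refine Nat.add_le_add_left ?_ _
    -- Only close vertices contribute: a common end gives a walk of length `2 * m`.
    have hsub : S.filter (G.CloseBy (2 * m) u) ⊆ S.erase u := by
      intro v hv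
      rw [Finset.mem_filter] at hv
      exact Finset.mem_erase.2 ⟨hv.2.1.symm, hv.1⟩
    rw [← Finset.sum_subset hsub]
    · rw [← smul_eq_mul]
      refine Finset.sum_le_card_nsmul _ _ _ fun v hv => ?_
      rw [Finset.mem_filter] at hv
      exact card_pathEnds_inter_le hA hD' hg hv.2.1 le_rfl
    · intro v hv hv'
      rw [Finset.mem_erase] at hv
      rw [Finset.card_eq_zero, Finset.eq_empty_iff_forall_notMem]
      intro w hw
      rw [Finset.mem_inter] at hw
      obtain ⟨p, -, hp⟩ := exists_isPath_of_mem_pathEnds hw.1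
      obtain ⟨q, -, hq⟩ := exists_isPath_of_mem_pathEnds hw.2
      exact hv' (Finset.mem_filter.2 ⟨hv.2, hv.1.symm, p.append q.reverse, by simp; omega⟩)
  have hsum : ∑ w, f w ^ 2 ≤ X + (∑ u ∈ S, (S.filter (G.CloseBy (2 * m) u)).card) * I := by
    rw [hf2, Finset.sum_mul, hXdef, ← Finset.sum_add_distrib]
    exact Finset.sum_le_sum hrow
  set E := ∑ u ∈ S, (S.filter (G.CloseBy (2 * m) u)).card
  -- From `X ^ 2 ≤ n * (X + E * I)` and `2 * n * X ≤ X ^ 2` follows `X ^ 2 ≤ 2 * n * E * I`,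
  -- contradicting `hsmall`.
  have h1 : (S.card * (D - 1) ^ m) ^ 2 ≤ X ^ 2 := Nat.pow_le_pow_left hX 2
  have h2 : S.card * (S.card * (D - 1) ^ (2 * m)) = (S.card * (D - 1) ^ m) ^ 2 := by ring
  have h3 : 2 * n * X ≤ X * X := Nat.mul_le_mul_right _ (hS.trans hX)
  have h4 : n * ∑ w, f w ^ 2 ≤ n * (X + E * I) := Nat.mul_le_mul_left _ hsum
  nlinarith

end SimpleGraph

/-! ### The Kleitman–Winston algorithm -/

open Classical in
/-- The subsets of `S` of size at most `d` that are independent for the relation `adj`. -/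
noncomputable def smallIndepSets {V : Type*} (adj : V → V → Prop) (d : ℕ) (S : Finset V) :
    Finset (Finset V) :=
  S.powerset.filter fun T => T.card ≤ d ∧ ∀ u ∈ T, ∀ v ∈ T, ¬ adj u v

theorem mem_smallIndepSets {V : Type*} {adj : V → V → Prop} {d : ℕ} {S T : Finset V} :
    T ∈ smallIndepSets adj d S ↔ T ⊆ S ∧ T.card ≤ d ∧ ∀ u ∈ T, ∀ v ∈ T, ¬ adj u v := by
  simp [smallIndepSets]

open Classical in
/-- The Kleitman–Winston bound on the number of small independent sets of a locally dense
relation. -/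
theorem card_smallIndepSets_le {V : Type*} {adj : V → V → Prop} {U : Finset V} {R β M : ℝ} {d : ℕ}
    (hM0 : 0 ≤ M)
    (hM : ∀ S : Finset V, (S.card : ℝ) ≤ R → ((S.powerset.filter (·.card ≤ d)).card : ℝ) ≤ M)
    (hdeg : ∀ S ⊆ U, R < S.card → ∃ u ∈ S, β * S.card ≤ (S.filter (adj u)).card)
    (t : ℕ) (S : Finset V) (hS : S ⊆ U) (ht : S.card * Real.exp (-(β * t)) ≤ R) :
    ((smallIndepSets adj d S).card : ℝ) ≤
      (S.card + 1 : ℝ) ^ t * M := by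
  induction S using Finset.strongInduction generalizing t with
  | H S ih =>
  by_cases hR : (S.card : ℝ) ≤ R
  · calc _ ≤ ((S.powerset.filter (·.card ≤ d)).card : ℝ) := by
          refine Nat.cast_le.2 (Finset.card_le_card fun T hT => ?_)
          rw [mem_smallIndepSets] at hT
          exact Finset.mem_filter.2 ⟨Finset.mem_powerset.2 hT.1, hT.2.1⟩
      _ ≤ M := hM S hR
      _ ≤ _ := le_mul_of_one_le_left hM0 (one_le_pow₀ (by simp))
  · rw [not_le] at hR
    obtain ⟨u, hu, hdu⟩ := hdeg S hS hR
    rcases t with _ | t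
    · simp only [CharP.cast_eq_zero, mul_zero, neg_zero, Real.exp_zero, mul_one] at ht
      linarith
    -- Sets avoiding `u` lie in `S₁`. A set containing `u` has its other vertices in `S₂`, which is
    -- smaller by a factor `exp (-β)`, so this branch spends one of the `t` steps.
    let S₁ := S.erase u
    let S₂ := S₁.filter fun v => ¬ adj u v
    have h1S : S₁ ⊂ S := Finset.erase_ssubset hu
    have h21 : S₂ ⊆ S₁ := Finset.filter_subset _ _
    have hc1 : S₁.card + 1 = S.card := Finset.card_erase_add_one hu
    have hc2 : S₂.card ≤ S₁.card := Finset.card_le_card h21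
    have hc1' : (S₁.card : ℝ) + 1 = S.card := by exact_mod_cast hc1
    have hc2' : (S₂.card : ℝ) ≤ S₁.card := by exact_mod_cast hc2
    have hc3 : (S₂.card : ℝ) ≤ S.card * Real.exp (-β) := by
      have h : S₂.card + (S.filter (adj u)).card ≤ S.card := by
        rw [← Finset.card_filter_add_card_filter_not (s := S) (adj u), add_comm]
        exact Nat.add_le_add_left (Finset.card_le_card
          (Finset.filter_subset_filter _ h1S.subset)) _
      have h' : (S₂.card : ℝ) + (S.filter (adj u)).card ≤ S.card := by exact_mod_cast h
      have := Real.add_one_le_exp (-β)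
      nlinarith [(Nat.cast_nonneg S.card : (0 : ℝ) ≤ S.card)]
    have hb1 := ih S₁ h1S (t + 1) (h1S.subset.trans hS)
      ((mul_le_mul_of_nonneg_right (by linarith) (Real.exp_pos _).le).trans ht)
    have hb2 := ih S₂ (h21.trans_ssubset h1S) t (h21.trans (h1S.subset.trans hS)) (by
      refine (mul_le_mul_of_nonneg_right hc3 (Real.exp_pos _).le).trans (le_trans (le_of_eq ?_) ht)
      rw [mul_assoc, ← Real.exp_add]
      push_cast
      ring_nf)
    have hP : (smallIndepSets adj d S).card ≤
        (smallIndepSets adj d S₁).card + (smallIndepSets adj d S₂).card := by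
      refine le_trans (Finset.card_le_card 
        (t := smallIndepSets adj d S₁ ∪ (smallIndepSets adj d S₂).image (insert u)) ?_)
        ((Finset.card_union_le _ _).trans (Nat.add_le_add_left Finset.card_image_le _))
      intro T hT
      rw [mem_smallIndepSets] at hT
      obtain ⟨hTS, hTd, hTi⟩ := hT
      by_cases huT : u ∈ T
      · refine Finset.mem_union_right _ (Finset.mem_image.2 ⟨T.erase u, ?_,
          Finset.insert_erase huT⟩)
        rw [mem_smallIndepSets]
        refine ⟨fun v hv => ?_, Finset.card_erase_le.trans hTd, fun v hv w hw =>
          hTi v (Finset.mem_of_mem_erase hv) w (Finset.mem_of_mem_erase hw)⟩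
        have hv' := Finset.mem_erase.1 hv
        exact Finset.mem_filter.2 ⟨Finset.mem_erase.2 ⟨hv'.1, hTS hv'.2⟩, hTi u huT v hv'.2⟩
      · refine Finset.mem_union_left _ ?_
        rw [mem_smallIndepSets]
        exact ⟨Finset.subset_erase.2 ⟨hTS, huT⟩, hTd, hTi⟩
    calc ((smallIndepSets adj d S).card : ℝ) ≤
        (smallIndepSets adj d S₁).card + (smallIndepSets adj d S₂).card := by exact_mod_cast hP
      _ ≤ (S₁.card + 1 : ℝ) ^ (t + 1) * M + (S₂.card + 1 : ℝ) ^ t * M := add_le_add hb1 hb2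
      _ ≤ (S.card : ℝ) ^ (t + 1) * M + (S.card : ℝ) ^ t * M := by
          rw [hc1']
          gcongr
          linarith
      _ = (S.card : ℝ) ^ t * (S.card + 1) * M := by ring
      _ ≤ (S.card + 1 : ℝ) ^ t * (S.card + 1) * M := by gcongr; linarith
      _ = _ := by ring

/-! ### Numerical estimates -/

theorem exists_log_pow_le_rpow (k l : ℕ) (hk : 1 ≤ k) (hl : 1 ≤ l) :
    ∃ C : ℝ, 0 < C ∧ ∀ n : ℕ, 1 ≤ n → Real.log (n + 1) ^ k ≤ C * (n : ℝ) ^ (1 / (l : ℝ)) := by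
  have hk' : (0 : ℝ) < k := by exact_mod_cast hk
  have hl' : (0 : ℝ) < l := by exact_mod_cast hl
  refine ⟨2 * (l * k) ^ k, by positivity, fun n hn => ?_⟩
  have hn' : (1 : ℝ) ≤ n := by exact_mod_cast hn
  have hlog : 0 ≤ Real.log (n + 1) := Real.log_nonneg (by linarith)
  have hε : (0 : ℝ) < 1 / (l * k) := by positivity
  have h1 := Real.log_le_rpow_div (x := (n : ℝ) + 1) (by linarith) hε
  rw [div_div_eq_mul_div, div_one] at h1
  calc Real.log (n + 1) ^ k ≤ (((n : ℝ) + 1) ^ (1 / ((l : ℝ) * k)) * (l * k)) ^ k :=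
        pow_le_pow_left₀ hlog h1 k
    _ = ((n : ℝ) + 1) ^ (1 / (l : ℝ)) * (l * k) ^ k := by
        rw [mul_pow, ← Real.rpow_natCast (((n : ℝ) + 1) ^ _), ← Real.rpow_mul (by linarith)]
        congr 2
        field_simp
    _ ≤ (2 * (n : ℝ)) ^ (1 / (l : ℝ)) * (l * k) ^ k := by
        gcongr
        linarith
    _ ≤ (2 * (n : ℝ) ^ (1 / (l : ℝ))) * (l * k) ^ k := by
        rw [Real.mul_rpow (by norm_num) (by linarith)]
        gcongr
        calc (2 : ℝ) ^ (1 / (l : ℝ)) ≤ 2 ^ (1 : ℝ) := by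
              apply Real.rpow_le_rpow_of_exponent_le (by norm_num)
              rw [div_le_one hl']
              exact_mod_cast hl
          _ = 2 := Real.rpow_one 2
    _ = _ := by ring

/-- Give `T` the weight `x ^ T.card`: each small set weighs at least `x ^ d`, and all subsets
together weigh `(x + 1) ^ S.card`. -/
theorem card_powerset_filter_le {V : Type*} (S : Finset V) (d : ℕ) {x : ℝ} (hx : 0 < x)
    (hx1 : x ≤ 1) :
    ((S.powerset.filter (·.card ≤ d)).card : ℝ) ≤ x⁻¹ ^ d * Real.exp (x * S.card) := by
  have h : ((S.powerset.filter (·.card ≤ d)).card : ℝ) * x ^ d ≤ Real.exp (x * S.card) := by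
    calc ((S.powerset.filter (·.card ≤ d)).card : ℝ) * x ^ d
        ≤ ∑ T ∈ S.powerset.filter (·.card ≤ d), x ^ T.card := by
          rw [← nsmul_eq_mul]
          refine Finset.card_nsmul_le_sum _ _ _ fun T hT => ?_
          exact pow_le_pow_of_le_one hx.le hx1 (Finset.mem_filter.1 hT).2
      _ ≤ ∑ T ∈ S.powerset, x ^ T.card :=
          Finset.sum_le_sum_of_subset_of_nonneg (Finset.filter_subset _ _)
            fun _ _ _ => by positivity
      _ = (x + 1) ^ S.card := by
          rw [← Finset.sum_pow_mul_eq_add_pow]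
          simp
      _ ≤ Real.exp x ^ S.card := pow_le_pow_left₀ (by linarith) (Real.add_one_le_exp x) _
      _ = _ := by rw [← Real.exp_nat_mul, mul_comm]
  rw [inv_pow, inv_mul_eq_div, le_div_iff₀ (by positivity)]
  exact h

/-- The number of sets of size at most `d` in a set of about `2 * y ^ l / (d / 2) ^ (l - 1)`
elements is exponential in `y`. -/
theorem card_powerset_filter_le_exp {V : Type*} (S : Finset V) {d m : ℕ} {y : ℝ} (hd : 1 ≤ d)
    (hy : 1 ≤ y) (hS : (S.card : ℝ) ≤ 2 ^ (m + 1) * y ^ (m + 1) / d ^ m + 1) :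
    ((S.powerset.filter (·.card ≤ d)).card : ℝ) ≤
      Real.exp ((m + 1 + 2 ^ (m + 1) + 1) * y) := by
  have hd' : (1 : ℝ) ≤ d := by exact_mod_cast hd
  have hy0 : 0 < y := by linarith
  rcases le_total y d with h | h
  · refine (card_powerset_filter_le S d one_pos le_rfl).trans ?_
    rw [inv_one, one_pow, one_mul, one_mul, Real.exp_le_exp]
    have h1 : 2 ^ (m + 1) * y ^ (m + 1) / d ^ m ≤ 2 ^ (m + 1) * y := by
      rw [div_le_iff₀ (by positivity), pow_succ y, mul_assoc, mul_comm (y ^ m)]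
      gcongr
    have : (0 : ℝ) ≤ m * y := by positivity
    nlinarith
  -- This choice makes both factors exponential in `y`: `x * S.card` is about `2 ^ (m + 1) * d`, and
  -- `x⁻¹ ^ d` is bounded through `z ≤ exp z` at `z = y / d`.
  · set x : ℝ := (d / y) ^ (m + 1) with hx
    have hx0 : 0 < x := by positivity
    have hx1 : x ≤ 1 := pow_le_one₀ (by positivity) ((div_le_one hy0).2 h)
    refine (card_powerset_filter_le S d hx0 hx1).trans ?_
    have h1 : x⁻¹ ^ d ≤ Real.exp ((m + 1) * y) := by
      have h2 : x⁻¹ = (y / d) ^ (m + 1) := by rw [hx, ← inv_pow, inv_div]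
      have h3 : y / d ≤ Real.exp (y / d) := by linarith [Real.add_one_le_exp (y / d)]
      calc x⁻¹ ^ d = ((y / d) ^ (m + 1)) ^ d := by rw [h2]
        _ ≤ (Real.exp (y / d) ^ (m + 1)) ^ d := by gcongr
        _ = Real.exp ((m + 1) * y) := by
            rw [← pow_mul, ← Real.exp_nat_mul]
            congr 1
            push_cast
            field_simp
    have h2 : x * S.card ≤ (2 ^ (m + 1) + 1) * y := by
      calc x * S.card ≤ x * (2 ^ (m + 1) * y ^ (m + 1) / d ^ m + 1) := by gcongr
        _ = 2 ^ (m + 1) * d + x := by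
            rw [hx, div_pow]
            field_simp
            ring
        _ ≤ 2 ^ (m + 1) * y + y := by
            gcongr
            linarith
        _ = _ := by ring
    calc x⁻¹ ^ d * Real.exp (x * S.card)
        ≤ Real.exp ((m + 1) * y) * Real.exp ((2 ^ (m + 1) + 1) * y) := by gcongr
      _ = _ := by
          rw [← Real.exp_add]
          ring_nf

/-! ### Counting neighbourhoods of a new vertex -/

-- Exactly `d - 1` neighbours are selected at each vertex of `U` and none elsewhere. The powers of
-- two come from `d / 2 ≤ d - 2`, valid for `4 ≤ d`.
open Classical in
theorem SimpleGraph.exists_le_card_closeBy {V : Type*} [Fintype V] {G : SimpleGraph V}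
    {U S : Finset V} {d m : ℕ}
    (hU : ∀ x ∈ U, G.neighborFinset x ⊆ U) (hd : ∀ x ∈ U, d ≤ G.degree x + 1) (hd4 : 4 ≤ d)
    (hm : 1 ≤ m) (hg : ((2 * (m + 1) : ℕ) : ℕ∞) < G.egirth) (hSU : S ⊆ U)
    (hS : 2 ^ (m + 1) * (Fintype.card V : ℝ) / d ^ m < S.card) :
    ∃ u ∈ S, (d : ℝ) ^ (m + 1) / (2 ^ (2 * m + 1) * m * Fintype.card V) * S.card ≤
      (S.filter (G.CloseBy (2 * m) u)).card := by
  have hd0 : (0 : ℝ) < d := by exact_mod_cast (by omega : 0 < d)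
  have hm0 : (0 : ℝ) < m := by exact_mod_cast hm
  have hA : ∀ x, ∃ A : Finset V, A ⊆ G.neighborFinset x ∧ A.card ≤ d - 1 ∧
      (x ∈ U → A.card = d - 1) := by
    intro x
    by_cases hx : x ∈ U
    · obtain ⟨A, hA, hAc⟩ := Finset.exists_subset_card_eq (s := G.neighborFinset x) (n := d - 1)
        (by rw [G.card_neighborFinset_eq_degree]; have := hd x hx; omega)
      exact ⟨A, hA, hAc.le, fun _ => hAc⟩
    · exact ⟨∅, by simp, by simp, fun h => absurd h hx⟩
  choose A hAN hAle hAeq using hA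
  have hScard : (0 : ℝ) < S.card := lt_of_le_of_lt (by positivity) hS
  have hne : S.Nonempty := Finset.card_pos.1 (by exact_mod_cast hScard)
  have hn0 : (0 : ℝ) < Fintype.card V := by
    have : Nonempty V := ⟨hne.choose⟩
    exact_mod_cast Fintype.card_pos
  have hD1 : (d : ℝ) / 2 ≤ ((d - 1 - 1 : ℕ) : ℝ) := by
    rw [Nat.cast_sub (by omega), Nat.cast_sub (by omega)]
    have : (4 : ℝ) ≤ d := by exact_mod_cast hd4
    push_cast
    linarith
  have hD2 : ((d - 1 : ℕ) : ℝ) ≤ d := by exact_mod_cast Nat.sub_le _ _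
  obtain ⟨u, hu, h⟩ := G.exists_many_closeBy (A := A) (U := U) (S := S) (D := d - 1) (m := m)
    (fun x w hw => (G.mem_neighborFinset x w).1 (hAN x hw))
    (fun x hx => (hAN x).trans (hU x hx)) (fun x hx => hAeq x hx) hAle hg hSU hne (by
      have h1 : 2 * (Fintype.card V : ℝ) ≤ S.card * ((d - 1 - 1 : ℕ) : ℝ) ^ m := by
        rw [div_lt_iff₀ (by positivity)] at hS
        calc 2 * (Fintype.card V : ℝ) = 2 ^ (m + 1) * Fintype.card V / 2 ^ m := by
              rw [pow_succ]; field_simp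
          _ ≤ S.card * d ^ m / 2 ^ m := by gcongr
          _ = S.card * (d / 2) ^ m := by rw [div_pow]; ring
          _ ≤ _ := by gcongr
      exact_mod_cast h1)
  refine ⟨u, hu, ?_⟩
  set e := (S.filter (G.CloseBy (2 * m) u)).card
  have h1 : (S.card : ℝ) * ((d - 1 - 1 : ℕ) : ℝ) ^ (2 * m) ≤
      2 * Fintype.card V * (m * ((d - 1 : ℕ) : ℝ) ^ (m - 1)) * e := by exact_mod_cast h
  have h2 : (S.card : ℝ) * (d / 2) ^ (2 * m) ≤ 2 * Fintype.card V * (m * d ^ (m - 1)) * e := by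
    calc (S.card : ℝ) * (d / 2) ^ (2 * m) ≤ S.card * ((d - 1 - 1 : ℕ) : ℝ) ^ (2 * m) := by gcongr
      _ ≤ _ := h1
      _ ≤ _ := by gcongr
  have h3 : (d : ℝ) ^ (2 * m) = d ^ (m + 1) * d ^ (m - 1) := by
    rw [← pow_add]
    congr 1
    omega
  rw [div_pow, h3] at h2
  rw [div_mul_eq_mul_div, div_le_iff₀ (by positivity)]
  have h4 : (0 : ℝ) < d ^ (m - 1) := by positivity
  refine le_of_mul_le_mul_right ?_ h4
  calc (d : ℝ) ^ (m + 1) * S.card * d ^ (m - 1)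
      = 2 ^ (2 * m) * (S.card * (d ^ (m + 1) * d ^ (m - 1) / 2 ^ (2 * m))) := by field_simp
    _ ≤ 2 ^ (2 * m) * (2 * Fintype.card V * (m * d ^ (m - 1)) * e) := by gcongr
    _ = _ := by ring

open Classical in
/-- The number of possible neighbourhoods of a new vertex of minimum degree `d`. -/
theorem SimpleGraph.exists_card_smallIndepSets_le (m : ℕ) (hm : 1 ≤ m) :
    ∃ C : ℝ, 0 < C ∧ ∀ (V : Type) [Fintype V] (G : SimpleGraph V) (U : Finset V) (d : ℕ),
      1 ≤ Fintype.card V → (∀ x ∈ U, G.neighborFinset x ⊆ U) → (∀ x ∈ U, d ≤ G.degree x + 1) →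
      ((2 * (m + 1) : ℕ) : ℕ∞) < G.egirth →
      ((smallIndepSets (G.CloseBy (2 * m)) d U).card : ℝ) ≤
        Real.exp (C * (Fintype.card V : ℝ) ^ (1 / ((m + 1 : ℕ) : ℝ))) := by
  obtain ⟨C₁, hC₁, h₁⟩ := exists_log_pow_le_rpow 1 (m + 1) le_rfl (by omega)
  obtain ⟨C₂, hC₂, h₂⟩ := exists_log_pow_le_rpow (m + 3) (m + 1) (by omega) (by omega)
  set K : ℝ := 2 ^ (2 * m + 1) * m with hK
  have hm0 : (0 : ℝ) < m := by exact_mod_cast hm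
  have hK0 : 0 < K := by positivity
  refine ⟨(3 * C₁ + 2) + (K * C₂ + C₁ + (m + 1 + 2 ^ (m + 1) + 1)), by positivity, ?_⟩
  intro V _ G U d hn hU hd hg
  replace h₁ := h₁ _ hn
  replace h₂ := h₂ _ hn
  set n := Fintype.card V
  set y : ℝ := (n : ℝ) ^ (1 / ((m + 1 : ℕ) : ℝ)) with hy
  set L : ℝ := Real.log (n + 1) with hL
  rw [pow_one] at h₁
  have hn' : (1 : ℝ) ≤ n := by exact_mod_cast hn
  have hy1 : 1 ≤ y := Real.one_le_rpow hn' (by positivity)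
  have hyn : y ^ (m + 1) = n := by
    rw [hy, one_div]
    exact Real.rpow_inv_natCast_pow (by linarith) (by omega)
  have hL0 : 0 < L := Real.log_pos (by linarith)
  have hexpL : Real.exp L = n + 1 := Real.exp_log (by linarith)
  have hUn : (U.card : ℝ) ≤ n := by exact_mod_cast Finset.card_le_univ U
  have hrest : 0 ≤ (K * C₂ + C₁ + (m + 1 + 2 ^ (m + 1) + 1)) * y := by positivity
  have hrest' : 0 ≤ (3 * C₁ + 2) * y := by positivity
  -- For small `d`, it suffices to count all sets of size at most `d`.
  by_cases hcase : d ≤ 3 ∨ d * L ≤ y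
  · have hdL : d * L ≤ (3 * C₁ + 1) * y := by
      rcases hcase with h | h
      · have : (d : ℝ) ≤ 3 := by exact_mod_cast h
        nlinarith
      · nlinarith [mul_pos hC₁ (by linarith : 0 < y)]
    calc ((smallIndepSets (G.CloseBy (2 * m)) d U).card : ℝ)
        ≤ ((U.powerset.filter (·.card ≤ d)).card : ℝ) := by
          refine Nat.cast_le.2 (Finset.card_le_card fun T hT => ?_)
          rw [mem_smallIndepSets] at hT
          exact Finset.mem_filter.2 ⟨Finset.mem_powerset.2 hT.1, hT.2.1⟩
      _ ≤ ((n + 1 : ℝ)⁻¹)⁻¹ ^ d * Real.exp ((n + 1 : ℝ)⁻¹ * U.card) :=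
          card_powerset_filter_le U d (by positivity) (inv_le_one_of_one_le₀ (by linarith))
      _ ≤ Real.exp (d * L) * Real.exp 1 := by
          rw [inv_inv, Real.exp_nat_mul, hexpL]
          gcongr
          rw [inv_mul_le_iff₀ (by linarith)]
          linarith
      _ ≤ _ := by
          rw [← Real.exp_add, Real.exp_le_exp]
          linarith
  · rw [not_or, not_le, not_le] at hcase
    obtain ⟨hd3, hdL⟩ := hcase
    have hd4 : 4 ≤ d := hd3
    have hd0 : (0 : ℝ) < d := by exact_mod_cast (by omega : 0 < d)
    set β : ℝ := (d : ℝ) ^ (m + 1) / (K * n) with hβ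
    have hβL : 1 ≤ β * (K * L ^ (m + 1)) := by
      have h : (n : ℝ) ≤ d ^ (m + 1) * L ^ (m + 1) := by
        rw [← hyn, ← mul_pow]
        gcongr
      rw [hβ]
      field_simp
      linarith
    -- As `β ≥ 1 / (K * L ^ (m + 1))`, this many steps bring the size of `U` down to `1`, which the
    -- `+ 1` in `R` permits. They cost `(n + 1) ^ t`, whence the power `m + 3` of `L` in `h₂`.
    set t : ℕ := ⌈K * L ^ (m + 2)⌉₊
    have ht1 : K * L ^ (m + 2) ≤ t := Nat.le_ceil _
    have ht2 : (t : ℝ) ≤ K * L ^ (m + 2) + 1 := (Nat.ceil_lt_add_one (by positivity)).le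
    have hβ0 : 0 < β := by positivity
    have hβt : L ≤ β * t := by
      calc L = 1 * L := (one_mul L).symm
        _ ≤ β * (K * L ^ (m + 1)) * L := by gcongr
        _ = β * (K * L ^ (m + 2)) := by ring
        _ ≤ _ := by gcongr
    have key := card_smallIndepSets_le (adj := G.CloseBy (2 * m)) (U := U)
      (R := 2 ^ (m + 1) * y ^ (m + 1) / d ^ m + 1) (β := β)
      (M := Real.exp ((m + 1 + 2 ^ (m + 1) + 1) * y)) (d := d) (Real.exp_pos _).le
      (fun S hS => card_powerset_filter_le_exp S (by omega) hy1 hS)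
      (fun S hSU hS => by
        obtain ⟨u, hu, h⟩ := exists_le_card_closeBy hU hd hd4 hm hg hSU (S := S)
          (by rw [hyn] at hS; linarith)
        exact ⟨u, hu, h⟩) t U subset_rfl (by
        have h : U.card * Real.exp (-(β * t)) ≤ 1 := by
          rw [Real.exp_neg, ← div_eq_mul_inv, div_le_one (Real.exp_pos _)]
          calc (U.card : ℝ) ≤ n + 1 := by linarith
            _ = Real.exp L := hexpL.symm
            _ ≤ _ := Real.exp_le_exp.2 hβt
        have : (0 : ℝ) ≤ 2 ^ (m + 1) * y ^ (m + 1) / d ^ m := by positivity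
        linarith)
    refine key.trans ?_
    calc (U.card + 1 : ℝ) ^ t * Real.exp ((m + 1 + 2 ^ (m + 1) + 1) * y)
        ≤ (n + 1 : ℝ) ^ t * Real.exp ((m + 1 + 2 ^ (m + 1) + 1) * y) := by gcongr
      _ = Real.exp (t * L + (m + 1 + 2 ^ (m + 1) + 1) * y) := by
          rw [← hexpL, ← Real.exp_nat_mul, ← Real.exp_add]
      _ ≤ _ := by
          rw [Real.exp_le_exp]
          have h : t * L ≤ K * (C₂ * y) + C₁ * y := by
            calc t * L ≤ (K * L ^ (m + 2) + 1) * L := by gcongr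
              _ = K * L ^ (m + 3) + L := by ring
              _ ≤ _ := by gcongr
          linarith

/-! ### Counting graphs by minimum-degree deletion -/

namespace SimpleGraph

open Classical in
/-- The graphs of extended girth larger than `g` all of whose edges lie in `s`. -/
noncomputable def largeGirthOn {V : Type*} [Fintype V] (g : ℕ∞) (s : Finset V) :
    Finset (SimpleGraph V) :=
  Finset.univ.filter fun G => g < G.egirth ∧ ∀ u w, G.Adj u w → u ∈ s

theorem mem_largeGirthOn {V : Type*} [Fintype V] {g : ℕ∞} {s : Finset V} {G : SimpleGraph V} :
    G ∈ largeGirthOn g s ↔ g < G.egirth ∧ ∀ u w, G.Adj u w → u ∈ s := by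
  simp [largeGirthOn]

/-- Neighbours of `v` are far apart in `G - v` if `G` has large girth. -/
theorem not_closeBy_of_adj {V : Type*} {G : SimpleGraph V} {v u w : V} {m : ℕ}
    (hg : ((2 * (m + 1) : ℕ) : ℕ∞) < G.egirth) (hu : G.Adj v u) (hw : G.Adj v w) :
    ¬ (G.deleteIncidenceSet v).CloseBy (2 * m) u w := by
  classical
  rintro ⟨hne, p, hp⟩
  have hle := G.deleteIncidenceSet_le v
  have hl := p.length_bypass_le_length
  have h1 : (p.bypass.mapLe hle).IsPath := p.bypass_isPath.mapLe hle
  have h2 : (Walk.cons hu.symm (Walk.cons hw Walk.nil)).IsPath := by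
    simp [hu.ne', hw.ne, hne]
  have h3 := h1.eq_of_lt_egirth h2 (lt_of_le_of_lt
    (by simp only [Walk.length_map, Walk.length_cons, Walk.length_nil]; norm_cast; omega) hg)
  have h4 : s(u, v) ∈ p.bypass.edges := by
    rw [← Walk.edges_mapLe_eq_edges hle, h3]
    simp
  have h5 := p.bypass.edges_subset_edgeSet h4
  rw [mem_edgeSet, deleteIncidenceSet_adj] at h5
  exact h5.2.2 rfl

-- `G'` and the neighbourhood of `v` determine the graph, and that neighbourhood is independent for
-- closeness in `G'`. The factor in front of `K` counts the possible degrees of `v`.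
open Classical in
theorem card_fiber_deleteIncidenceSet_le {V : Type} [Fintype V] {m : ℕ} {K : ℝ} (hK0 : 0 ≤ K)
    (hK : ∀ (G : SimpleGraph V) (U : Finset V) (d : ℕ),
      (∀ x ∈ U, G.neighborFinset x ⊆ U) → (∀ x ∈ U, d ≤ G.degree x + 1) →
      ((2 * (m + 1) : ℕ) : ℕ∞) < G.egirth →
      ((smallIndepSets (G.CloseBy (2 * m)) d U).card : ℝ) ≤ K)
    (s : Finset V) (v : V) (G' : SimpleGraph V) :
    (((largeGirthOn (2 * (m + 1) : ℕ) s).filter fun G => (∀ u ∈ s, G.degree v ≤ G.degree u) ∧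
      G.deleteIncidenceSet v = G').card : ℝ) ≤ (Fintype.card V + 1) * K := by
  set F := (largeGirthOn (2 * (m + 1) : ℕ) s).filter fun G =>
    (∀ u ∈ s, G.degree v ≤ G.degree u) ∧ G.deleteIncidenceSet v = G' with hF
  -- Values of `d` too large for the degrees of `G'` occur for no graph in the fibre.
  let I : ℕ → Finset (Finset V) := fun d => if (∀ x ∈ s.erase v, d ≤ G'.degree x + 1) then
    smallIndepSets (G'.CloseBy (2 * m)) d (s.erase v) else ∅
  rcases F.eq_empty_or_nonempty with h0 | ⟨G₀, hG₀⟩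
  · rw [h0, Finset.card_empty, Nat.cast_zero]
    positivity
  have hmem : ∀ G ∈ F, ((2 * (m + 1) : ℕ) : ℕ∞) < G.egirth ∧ (∀ u w, G.Adj u w → u ∈ s) ∧
      (∀ u ∈ s, G.degree v ≤ G.degree u) ∧ G.deleteIncidenceSet v = G' := by
    intro G hG
    rw [hF, Finset.mem_filter, mem_largeGirthOn] at hG
    exact ⟨hG.1.1, hG.1.2, hG.2⟩
  have hI : ∀ d, ((I d).card : ℝ) ≤ K := by
    intro d
    simp only [I]
    split_ifs with hd
    · obtain ⟨hg, hs, -, rfl⟩ := hmem G₀ hG₀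
      refine hK _ _ d ?_ hd (hg.trans_le (egirth_anti (G₀.deleteIncidenceSet_le v)))
      intro x _ w hw
      rw [mem_neighborFinset, deleteIncidenceSet_adj] at hw
      exact Finset.mem_erase.2 ⟨hw.2.2, hs w x hw.1.symm⟩
    · simpa using hK0
  have hmaps : ∀ G ∈ F, G.neighborFinset v ∈ (Finset.range (Fintype.card V + 1)).biUnion I := by
    intro G hG
    obtain ⟨hg, hs, hdeg, hGG'⟩ := hmem G hG
    have hadj : ∀ a b, G'.Adj a b ↔ G.Adj a b ∧ a ≠ v ∧ b ≠ v := fun a b => by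
      rw [← hGG', deleteIncidenceSet_adj]
    rw [Finset.mem_biUnion]
    refine ⟨G.degree v, Finset.mem_range.2 (Nat.lt_succ_of_le (Finset.card_le_univ _)), ?_⟩
    have hval : ∀ x ∈ s.erase v, G.degree v ≤ G'.degree x + 1 := by
      intro x hx
      rw [Finset.mem_erase] at hx
      refine (hdeg x hx.2).trans ?_
      rw [← card_neighborFinset_eq_degree, ← card_neighborFinset_eq_degree]
      refine le_trans (Finset.card_le_card (t := insert v _) ?_) (Finset.card_insert_le _ _)
      intro w hw
      rw [mem_neighborFinset] at hw
      rw [Finset.mem_insert, mem_neighborFinset, hadj]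
      by_cases hwv : w = v
      · exact Or.inl hwv
      · exact Or.inr ⟨hw, hx.1, hwv⟩
    simp only [I]
    rw [if_pos hval, mem_smallIndepSets]
    refine ⟨fun w hw => ?_, le_rfl, fun u hu w hw => ?_⟩
    · rw [mem_neighborFinset] at hw
      exact Finset.mem_erase.2 ⟨hw.ne', hs w v hw.symm⟩
    · rw [mem_neighborFinset] at hu hw
      exact hGG' ▸ not_closeBy_of_adj hg hu hw
  have hinj : Set.InjOn (fun G : SimpleGraph V => G.neighborFinset v) F := by
    intro G hG H hH hGH
    have h1 := (hmem G hG).2.2.2.trans (hmem H hH).2.2.2.symm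
    have hv : ∀ w, G.Adj v w ↔ H.Adj v w := fun w => by
      rw [← mem_neighborFinset, ← mem_neighborFinset]
      exact Finset.ext_iff.1 hGH w
    ext a b
    by_cases ha : a = v
    · subst ha; exact hv b
    by_cases hb : b = v
    · subst hb; rw [G.adj_comm, H.adj_comm]; exact hv a
    have h2 := congrArg (fun K : SimpleGraph V => K.Adj a b) h1
    simpa [deleteIncidenceSet_adj, ha, hb] using h2
  have hcard : F.card ≤ ((Finset.range (Fintype.card V + 1)).biUnion I).card :=
    Finset.card_le_card_of_injOn _ hmaps hinj
  calc (F.card : ℝ) ≤ ∑ d ∈ Finset.range (Fintype.card V + 1), ((I d).card : ℝ) := by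
        exact_mod_cast hcard.trans Finset.card_biUnion_le
    _ ≤ ∑ d ∈ Finset.range (Fintype.card V + 1), K := Finset.sum_le_sum fun d _ => hI d
    _ = _ := by simp

-- Each deletion costs a factor `n` for the choice of a minimum-degree vertex and `(n + 1) * K` for
-- its neighbourhood.
open Classical in
theorem card_largeGirthOn_le {V : Type} [Fintype V] {m : ℕ} {K : ℝ} (hK0 : 0 ≤ K)
    (hK : ∀ (G : SimpleGraph V) (U : Finset V) (d : ℕ),
      (∀ x ∈ U, G.neighborFinset x ⊆ U) → (∀ x ∈ U, d ≤ G.degree x + 1) →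
      ((2 * (m + 1) : ℕ) : ℕ∞) < G.egirth →
      ((smallIndepSets (G.CloseBy (2 * m)) d U).card : ℝ) ≤ K) (s : Finset V) :
    ((largeGirthOn (2 * (m + 1) : ℕ) s).card : ℝ) ≤
      (Fintype.card V * ((Fintype.card V + 1) * K)) ^ s.card := by
  induction s using Finset.strongInduction with
  | H s ih =>
  rcases s.eq_empty_or_nonempty with rfl | hs
  · rw [Finset.card_empty, pow_zero]
    norm_cast
    rw [Finset.card_le_one]
    intro G hG H hH
    rw [mem_largeGirthOn] at hG hH
    ext a b
    exact ⟨fun h => absurd (hG.2 a b h) (by simp), fun h => absurd (hH.2 a b h) (by simp)⟩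
  let P : V → Finset (SimpleGraph V) := fun v =>
    (largeGirthOn (2 * (m + 1) : ℕ) s).filter fun G => ∀ u ∈ s, G.degree v ≤ G.degree u
  set n : ℝ := (Fintype.card V : ℝ) with hn
  set B : ℝ := n * ((n + 1) * K) with hB
  have hB0 : 0 ≤ B := by positivity
  have hcover : largeGirthOn (2 * (m + 1) : ℕ) s ⊆ s.biUnion P := by
    intro G hG
    obtain ⟨v, hv, hmin⟩ := Finset.exists_min_image s (fun u => G.degree u) hs
    exact Finset.mem_biUnion.2 ⟨v, hv, Finset.mem_filter.2 ⟨hG, hmin⟩⟩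
  have hP : ∀ v ∈ s, ((P v).card : ℝ) ≤ B ^ (s.card - 1) * ((n + 1) * K) := by
    intro v hv
    have hmaps : ∀ G ∈ P v, G.deleteIncidenceSet v ∈
        largeGirthOn (2 * (m + 1) : ℕ) (s.erase v) := by
      intro G hG
      have hG' := mem_largeGirthOn.1 (Finset.mem_filter.1 hG).1
      rw [mem_largeGirthOn]
      refine ⟨hG'.1.trans_le (egirth_anti (G.deleteIncidenceSet_le v)), fun u w h => ?_⟩
      rw [deleteIncidenceSet_adj] at h
      exact Finset.mem_erase.2 ⟨h.2.1, hG'.2 u w h.1⟩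
    rw [Finset.card_eq_sum_card_fiberwise hmaps, Nat.cast_sum]
    have hfib : ∀ G' ∈ largeGirthOn (2 * (m + 1) : ℕ) (s.erase v),
        (((P v).filter fun G => G.deleteIncidenceSet v = G').card : ℝ) ≤ (n + 1) * K := by
      intro G' _
      simp only [P, Finset.filter_filter]
      exact card_fiber_deleteIncidenceSet_le hK0 hK s v G'
    refine (Finset.sum_le_card_nsmul _ _ _ hfib).trans ?_
    rw [nsmul_eq_mul, ← Finset.card_erase_of_mem hv]
    gcongr
    exact ih _ (Finset.erase_ssubset hv)
  have hsn : (s.card : ℝ) ≤ n := by rw [hn]; exact_mod_cast Finset.card_le_univ s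
  calc ((largeGirthOn (2 * (m + 1) : ℕ) s).card : ℝ) ≤ ∑ v ∈ s, ((P v).card : ℝ) := by
        exact_mod_cast (Finset.card_le_card hcover).trans Finset.card_biUnion_le
    _ ≤ s.card • (B ^ (s.card - 1) * ((n + 1) * K)) := Finset.sum_le_card_nsmul _ _ _ hP
    _ ≤ n * (B ^ (s.card - 1) * ((n + 1) * K)) := by
        rw [nsmul_eq_mul]
        gcongr
    _ = B ^ (s.card - 1) * B := by rw [hB]; ring
    _ = B ^ s.card := pow_sub_one_mul (Finset.card_pos.2 hs).ne' B

/-- The number of graphs on `n` vertices of girth larger than `2 * l` is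
`exp (O (n ^ (1 + 1 / l)))`. -/
theorem exists_card_egirth_gt_le (l : ℕ) (hl : 2 ≤ l) :
    ∃ C : ℝ, 0 < C ∧ ∀ n : ℕ,
      (({G : SimpleGraph (Fin n) | ((2 * l : ℕ) : ℕ∞) < G.egirth}.ncard : ℝ)
      ≤ Real.exp (C * (n : ℝ) ^ (1 + 1 / (l : ℝ)))) := by
  classical
  obtain ⟨m, rfl⟩ : ∃ m, l = m + 1 := ⟨l - 1, by omega⟩
  obtain ⟨C, hC, h⟩ := exists_card_smallIndepSets_le m (by omega)
  obtain ⟨C₁, hC₁, h₁⟩ := exists_log_pow_le_rpow 1 (m + 1) le_rfl (by omega)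
  refine ⟨2 * C₁ + C, by positivity, fun n => ?_⟩
  have hset : {G : SimpleGraph (Fin n) | ((2 * (m + 1) : ℕ) : ℕ∞) < G.egirth} =
      largeGirthOn (2 * (m + 1) : ℕ) (Finset.univ : Finset (Fin n)) := by
    ext G
    simp [mem_largeGirthOn]
  rw [hset, Set.ncard_coe_finset]
  rcases Nat.eq_zero_or_pos n with rfl | hn
  · refine le_trans (b := 1) ?_ (Real.one_le_exp (by positivity))
    exact_mod_cast Finset.card_le_one_of_subsingleton _
  have hcard : Fintype.card (Fin n) = n := Fintype.card_fin n
  set y : ℝ := (n : ℝ) ^ (1 / ((m + 1 : ℕ) : ℝ)) with hy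
  have key := card_largeGirthOn_le (V := Fin n) (m := m) (K := Real.exp (C * y))
    (Real.exp_pos _).le (fun G U d h1 h2 h3 => by
      have := h (Fin n) G U d (by rw [hcard]; exact hn) h1 h2 h3
      rwa [hcard] at this) Finset.univ
  rw [Finset.card_univ, hcard] at key
  refine key.trans ?_
  have hn' : (1 : ℝ) ≤ n := by exact_mod_cast hn
  have hL := h₁ n hn
  rw [pow_one] at hL
  have hexpL : Real.exp (Real.log (n + 1)) = n + 1 := Real.exp_log (by linarith)
  calc ((n : ℝ) * ((n + 1) * Real.exp (C * y))) ^ n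
      ≤ (((n : ℝ) + 1) * ((n + 1) * Real.exp (C * y))) ^ n := by
        gcongr
        linarith
    _ = Real.exp (n * (2 * Real.log (n + 1) + C * y)) := by
        rw [Real.exp_nat_mul, Real.exp_add, two_mul, Real.exp_add, hexpL, mul_assoc]
    _ ≤ Real.exp (n * (2 * (C₁ * y) + C * y)) := by gcongr
    _ = _ := by
        rw [Real.rpow_add (by linarith), Real.rpow_one, ← hy]
        ring_nf

end SimpleGraph

/-! ### From Berge cycles to linear cycles -/

namespace Hypergraph

variable {α : Type*} {H : Hypergraph α}

/-- A cyclic sequence of distinct vertices `v i` and distinct edges `e i` such that `e i` contains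
`v i` and `v (i + 1)`. -/
def IsBergeCycle (H : Hypergraph α) (k : ℕ) (v : ZMod k → α) (e : ZMod k → Set α) : Prop :=
  Function.Injective v ∧ Function.Injective e ∧ ∀ i, e i ∈ E(H) ∧ v i ∈ e i ∧ v (i + 1) ∈ e i

theorem val_add_one_eq (k : ℕ) [NeZero k] (i : ZMod k) : (i + 1).val = (i.val + 1) % k := by
  rw [ZMod.val_add, ZMod.val_one_eq_one_mod, Nat.add_mod_mod]

theorem natCast_inj_of_lt {k s t : ℕ} (hs : s < k) (ht : t < k) (h : (s : ZMod k) = t) : s = t := by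
  rw [ZMod.natCast_eq_natCast_iff', Nat.mod_eq_of_lt hs, Nat.mod_eq_of_lt ht] at h
  exact h

/-- A vertex common to `e i` and `e (i + a)` short-cuts a Berge cycle. -/
theorem IsBergeCycle.shortcut {k : ℕ} {v : ZMod k → α} {e : ZMod k → Set α}
    (h : H.IsBergeCycle k v e) {i : ZMod k} {a : ℕ} (hak : a < k) {x : α}
    (hx : x ∈ e i) (hx' : x ∈ e (i + a)) (hxv : ∀ t : ℕ, 1 ≤ t → t ≤ a → x ≠ v (i + t)) :
    ∃ v' e', H.IsBergeCycle (a + 1) v' e' := by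
  obtain ⟨hv, he, hm⟩ := h
  refine ⟨fun j => if j.val = 0 then x else v (i + (j.val : ℕ)), fun j => e (i + (j.val : ℕ)),
    ?_, ?_, ?_⟩
  · intro s t hst
    have hs := ZMod.val_lt s
    have ht := ZMod.val_lt t
    apply ZMod.val_injective
    by_cases h0 : s.val = 0 <;> by_cases h1 : t.val = 0 <;> 
      simp only [h0, h1, if_true, if_false] at hst ⊢
    · exact absurd hst (hxv _ (by omega) (by omega))
    · exact absurd hst.symm (hxv _ (by omega) (by omega))
    · exact natCast_inj_of_lt (by omega) (by omega) (add_left_cancel (hv hst))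
  · intro s t hst
    have hs := ZMod.val_lt s
    have ht := ZMod.val_lt t
    apply ZMod.val_injective
    exact natCast_inj_of_lt (by omega) (by omega) (add_left_cancel (he hst))
  · intro j
    have hj := ZMod.val_lt j
    refine ⟨(hm _).1, ?_, ?_⟩
    · by_cases h0 : j.val = 0
      · simpa [h0] using hx
      · simpa [h0] using (hm _).2.1
    · rcases Nat.lt_or_ge j.val a with h0 | h0
      · have h1 : (j + 1).val = j.val + 1 := by
          rw [val_add_one_eq, Nat.mod_eq_of_lt (by omega)]
        have := (hm (i + (j.val : ℕ))).2.2
        simp only [h1, Nat.succ_ne_zero, if_false]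
        push_cast
        rwa [← add_assoc]
      · have h1 : j.val = a := by omega
        have h2 : (j + 1).val = 0 := by rw [val_add_one_eq, h1, Nat.mod_self]
        simpa only [h2, h1, if_true] using hx'

/-- If non-consecutive edges are disjoint, linearity makes the cycle linear. Otherwise a vertex
common to two of them short-cuts it along one of the two arcs, to a length from `3` to `k - 1`. -/
theorem IsBergeCycle.exists_containsLinearCycle (hH : H.IsLinear) {k : ℕ} (hk : 3 ≤ k)
    {v : ZMod k → α} {e : ZMod k → Set α} (h : H.IsBergeCycle k v e) :
    ∃ k' ≤ k, H.ContainsLinearCycle k' := by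
  induction k using Nat.strong_induction_on with
  | _ k ih =>
  by_cases hd : ∀ i j, i ≠ j → j ≠ i + 1 → i ≠ j + 1 → Disjoint (e i) (e j)
  · obtain ⟨hv, he, hm⟩ := h
    refine ⟨k, le_rfl, e, ⟨hk, ⟨fun i => v (i + 1), hv.comp (add_left_injective 1), fun i => ?_⟩,
      hd⟩, fun i => (hm i).1⟩
    have hne : e i ≠ e (i + 1) := by
      intro heq
      have h1 : ((1 : ℕ) : ZMod k) = (0 : ℕ) := by
        have := he heq
        push_cast
        exact (left_eq_add.1 this)
      have := natCast_inj_of_lt (by omega) (by omega) h1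
      omega
    have hmem : v (i + 1) ∈ e i ∩ e (i + 1) := ⟨(hm i).2.2, (hm (i + 1)).2.1⟩
    refine Set.Subset.antisymm (fun y hy => ?_) (Set.singleton_subset_iff.2 hmem)
    exact Set.encard_le_one_iff.1 (hH _ (hm i).1 _ (hm (i + 1)).1 hne) y _ hy hmem
  · push Not at hd
    obtain ⟨i, j, hij, hji, hij', hnd⟩ := hd
    rw [Set.not_disjoint_iff] at hnd
    obtain ⟨x, hxi, hxj⟩ := hnd
    have : NeZero k := ⟨by omega⟩
    obtain ⟨a, hak, rfl⟩ : ∃ a : ℕ, a < k ∧ j = i + a :=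
      ⟨(j - i).val, ZMod.val_lt _, by simp⟩
    have ha0 : a ≠ 0 := by rintro rfl; simp at hij
    have ha1 : a ≠ 1 := by rintro rfl; simp at hji
    have hkk : ((k : ℕ) : ZMod k) = 0 := ZMod.natCast_self k
    have ha2 : a + 1 ≠ k := by
      intro hak'
      apply hij'
      rw [add_assoc, ← Nat.cast_succ, Nat.succ_eq_add_one, hak', hkk, add_zero]
    have hcast : ((k - a : ℕ) : ZMod k) = -a := by
      rw [Nat.cast_sub hak.le, hkk, zero_sub]
    by_cases hxv : ∀ t : ℕ, 1 ≤ t → t ≤ a → x ≠ v (i + t)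
    · obtain ⟨v', e', h'⟩ := h.shortcut hak hxi hxj hxv
      obtain ⟨k', hk', hc⟩ := ih (a + 1) (by omega) (by omega) h'
      exact ⟨k', by omega, hc⟩
    -- The common vertex is a cycle vertex on this arc, hence not on the complementary one.
    · push Not at hxv
      obtain ⟨t, ht1, hta, rfl⟩ := hxv
      obtain ⟨v', e', h'⟩ := h.shortcut (i := i + a) (a := k - a) (by omega) hxj
        (by rw [hcast, add_neg_cancel_right]; exact hxi) (by
          intro s hs1 hs2 heq
          have h1 := h.1 heq
          rw [add_assoc] at h1
          have h2 := add_left_cancel h1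
          rw [← Nat.cast_add, ZMod.natCast_eq_natCast_iff', Nat.mod_eq_of_lt (by omega)] at h2
          rcases Nat.lt_or_ge (a + s) k with h3 | h3
          · rw [Nat.mod_eq_of_lt h3] at h2
            omega
          · rw [show a + s = k by omega, Nat.mod_self] at h2
            omega)
      obtain ⟨k', hk', hc⟩ := ih (k - a + 1) (by omega) (by omega) h'
      exact ⟨k', by omega, hc⟩

theorem IsBergeCycle.girth_le (hH : H.IsLinear) {k : ℕ} (hk : 3 ≤ k)
    {v : ZMod k → α} {e : ZMod k → Set α} (h : H.IsBergeCycle k v e) : H.girth ≤ k := by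
  obtain ⟨k', hk', hc⟩ := h.exists_containsLinearCycle hH hk
  exact (iInf₂_le k' hc).trans (by exact_mod_cast hk')

/-! ### Encoding hypergraphs by pair graphs -/

/-- The graph that has the edge `f e` for every edge `e` of the hypergraph. -/
def pairGraph (H : Hypergraph α) (f : Set α → Sym2 α) : SimpleGraph α :=
  SimpleGraph.fromEdgeSet (f '' E(H))

/-- Distinct edges of a cycle come from distinct hyperedges, as `f` is a function; these form a
Berge cycle of the same length. -/
theorem lt_egirth_pairGraph (hH : H.IsLinear) {f : Set α → Sym2 α}
    (hf : ∀ e ∈ E(H), ∀ x ∈ f e, x ∈ e) {g : ℕ} (hg : (g : ℕ∞) < H.girth) :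
    (g : ℕ∞) < (H.pairGraph f).egirth := by
  rw [← ENat.add_one_le_iff (ENat.natCast_ne_top g), SimpleGraph.le_egirth]
  intro a c hc
  by_contra hcon
  have hk := hc.three_le_length
  have hkg : c.length ≤ g := by
    rw [not_le] at hcon
    have : c.length < g + 1 := by exact_mod_cast hcon
    omega
  have : NeZero c.length := ⟨by omega⟩
  have hex : ∀ i : ZMod c.length, ∃ e ∈ E(H),
      f e = s(c.getVert i.val, c.getVert (i.val + 1)) := by
    intro i
    have hadj := c.adj_getVert_succ (ZMod.val_lt i)
    exact ((SimpleGraph.fromEdgeSet_adj _).1 hadj).1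
  choose e he hfe using hex
  have hsucc : ∀ i : ZMod c.length, c.getVert (i + 1).val = c.getVert (i.val + 1) := by
    intro i
    have hi := ZMod.val_lt i
    rw [val_add_one_eq]
    rcases Nat.lt_or_ge (i.val + 1) c.length with h | h
    · rw [Nat.mod_eq_of_lt h]
    · rw [show i.val + 1 = c.length by omega, Nat.mod_self, SimpleGraph.Walk.getVert_zero,
        SimpleGraph.Walk.getVert_length]
  have hv : Function.Injective fun i : ZMod c.length => c.getVert i.val := by
    intro i j hij
    have hi := ZMod.val_lt i
    have hj := ZMod.val_lt j
    exact ZMod.val_injective _ (hc.getVert_injOn' (by simp only [Set.mem_ofPred_eq]; omega)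
      (by simp only [Set.mem_ofPred_eq]; omega) hij)
  have hb : H.IsBergeCycle c.length (fun i => c.getVert i.val) e := by
    refine ⟨hv, fun i j hij => ?_, fun i => ⟨he i, hf _ (he i) _ ?_, hf _ (he i) _ ?_⟩⟩
    · have h1 := congrArg f hij
      rw [hfe, hfe, ← hsucc, ← hsucc, Sym2.eq_iff] at h1
      rcases h1 with h1 | h1
      · exact hv h1.1
      -- The reversed match forces `2 = 0` modulo a length of at least `3`.
      · exfalso
        have h2 := hv h1.1
        have h3 := hv h1.2
        have h4 : ((2 : ℕ) : ZMod c.length) = (0 : ℕ) := by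
          rw [h2, add_assoc] at h3
          push_cast
          rw [← one_add_one_eq_two]
          exact add_eq_left.1 h3
        have := natCast_inj_of_lt (by omega) (by omega) h4
        omega
    · rw [hfe]; simp
    · rw [hfe]; simp [hsucc]
  exact absurd (hg.trans_le (hb.girth_le hH hk)) (not_lt.2 (by exact_mod_cast hkg))

theorem IsLinear.eq_of_mem (hH : H.IsLinear) {e f : Set α} (he : e ∈ E(H)) (hf : f ∈ E(H))
    {x y : α} (hxy : x ≠ y) (hxe : x ∈ e) (hye : y ∈ e) (hxf : x ∈ f) (hyf : y ∈ f) : e = f := by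
  by_contra hne
  exact hxy (Set.encard_le_one_iff.1 (hH e he f hf hne) x y ⟨hxe, hxf⟩ ⟨hye, hyf⟩)

/-- In a linear hypergraph without linear triangles, three pairwise adjacent vertices lie in a
common edge. -/
theorem mem_of_pairwise_adj (hH : H.IsLinear) (hg : (3 : ℕ∞) < H.girth) {x y z : α}
    {e₁ e₂ e₃ : Set α} (h₁ : e₁ ∈ E(H)) (h₂ : e₂ ∈ E(H)) (h₃ : e₃ ∈ E(H)) (hxy : x ≠ y)
    (hyz : y ≠ z) (hxz : x ≠ z) (hx₁ : x ∈ e₁) (hy₁ : y ∈ e₁) (hy₂ : y ∈ e₂) (hz₂ : z ∈ e₂)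
    (hz₃ : z ∈ e₃) (hx₃ : x ∈ e₃) : z ∈ e₁ := by
  by_contra hz
  have h12 : e₁ ≠ e₂ := by rintro rfl; exact hz hz₂
  have h13 : e₁ ≠ e₃ := by rintro rfl; exact hz hz₃
  have h23 : e₂ ≠ e₃ := by
    rintro rfl
    exact h12 (hH.eq_of_mem h₁ h₂ hxy hx₁ hy₁ hx₃ hy₂)
  have hb : H.IsBergeCycle 3 (![x, y, z] : Fin 3 → α) (![e₁, e₂, e₃] : Fin 3 → Set α) := by
    refine ⟨?_, ?_, ?_⟩
    · have : Function.Injective (![x, y, z] : Fin 3 → α) := by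
        intro i j hij
        fin_cases i <;> fin_cases j <;> simp_all
      exact this
    · have : Function.Injective (![e₁, e₂, e₃] : Fin 3 → Set α) := by
        intro i j hij
        fin_cases i <;> fin_cases j <;> simp_all
      exact this
    · intro i
      change Fin 3 at i
      fin_cases i
      · exact ⟨h₁, hx₁, hy₁⟩
      · exact ⟨h₂, hy₂, hz₂⟩
      · exact ⟨h₃, hz₃, hx₃⟩
  exact absurd (hg.trans_le (hb.girth_le hH le_rfl)) (lt_irrefl _)

/-- A linear `r`-graph without linear triangles can be read off from its pair graphs, for any
enumeration `ε` of the `r`-sets. -/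
theorem mem_edgeSet_iff_forall_pairGraph_adj {r : ℕ} (hr : 2 ≤ r) (hu : H.IsUniform r)
    (hH : H.IsLinear) (hg : (3 : ℕ∞) < H.girth) {ε : Set α → Fin r → α}
    (hε : ∀ e : Set α, e.encard = r → Function.Injective (ε e) ∧ Set.range (ε e) = e) (e : Set α) :
    e ∈ E(H) ↔ e.encard = r ∧ ∀ i j, i ≠ j →
      (H.pairGraph fun e => s(ε e i, ε e j)).Adj (ε e i) (ε e j) := by
  constructor
  · intro he
    refine ⟨hu e he, fun i j hij => ?_⟩
    rw [pairGraph, SimpleGraph.fromEdgeSet_adj]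
    exact ⟨⟨e, he, rfl⟩, (hε e (hu e he)).1.ne hij⟩
  · rintro ⟨hr', hadj⟩
    obtain ⟨hinj, hrange⟩ := hε e hr'
    have hcov : ∀ i j, i ≠ j → ∃ f ∈ E(H), ε e i ∈ f ∧ ε e j ∈ f := by
      intro i j hij
      have h := hadj i j hij
      rw [pairGraph, SimpleGraph.fromEdgeSet_adj] at h
      obtain ⟨⟨f, hf, hfe⟩, -⟩ := h
      have hmem : ∀ k, ε f k ∈ f := fun k =>
        (hε f (hu f hf)).2.subset (Set.mem_range_self k)
      rcases Sym2.eq_iff.1 hfe with h | h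
      · exact ⟨f, hf, h.1 ▸ hmem i, h.2 ▸ hmem j⟩
      · exact ⟨f, hf, h.2 ▸ hmem j, h.1 ▸ hmem i⟩
    -- An edge `f` through two vertices of `e` contains every third one, by the absence of
    -- triangles; equal sizes give `e = f`.
    let a : Fin r := ⟨0, by omega⟩
    let b : Fin r := ⟨1, by omega⟩
    have hab : a ≠ b := by simp [a, b]
    obtain ⟨f, hf, haf, hbf⟩ := hcov a b hab
    have hsub : e ⊆ f := by
      rw [← hrange]
      rintro _ ⟨c, rfl⟩
      by_cases hca : c = a
      · exact hca ▸ haf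
      by_cases hcb : c = b
      · exact hcb ▸ hbf
      obtain ⟨f₂, hf₂, hb₂, hc₂⟩ := hcov b c (Ne.symm hcb)
      obtain ⟨f₃, hf₃, hc₃, ha₃⟩ := hcov c a hca
      exact mem_of_pairwise_adj hH hg hf hf₂ hf₃ (hinj.ne hab) (hinj.ne (Ne.symm hcb))
        (hinj.ne (Ne.symm hca)) haf hbf hb₂ hc₂ hc₃ ha₃
    have hfin : e.Finite := Set.finite_of_encard_eq_coe hr'
    have hef : e = f := hfin.eq_of_subset_of_encard_le hsub (by rw [hu f hf, hr'])
    exact hef ▸ hf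

/-! ### Counting hypergraphs -/

theorem exists_enumeration (α : Type*) [Finite α] [Nonempty α] (r : ℕ) :
    ∃ ε : Set α → Fin r → α,
      ∀ e : Set α, e.encard = r → Function.Injective (ε e) ∧ Set.range (ε e) = e := by
  classical
  have := Fintype.ofFinite α
  have h : ∀ e : Set α, ∃ φ : Fin r → α,
      e.encard = r → Function.Injective φ ∧ Set.range φ = e := by
    intro e
    by_cases he : e.encard = r
    · have hc : e.toFinset.card = r := by
        rw [Set.encard_eq_coe_toFinset_card] at he
        exact_mod_cast he
      let φ := (e.toFinset.equivFinOfCardEq hc).symm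
      refine ⟨fun i => (φ i : α), fun _ => ⟨Subtype.val_injective.comp φ.injective, ?_⟩⟩
      have h1 := φ.surjective.range_comp (Subtype.val : e.toFinset → α)
      rw [Subtype.range_val] at h1
      simpa [Function.comp_def] using h1
    · exact ⟨fun _ => Classical.arbitrary α, fun h => absurd h he⟩
  choose ε hε using h
  exact ⟨ε, hε⟩

theorem ncard_forbLinear_le (n r g : ℕ) [NeZero n] (hr : 2 ≤ r) (hg : 3 ≤ g) :
    (forbLinear n r g).ncard ≤
      {G : SimpleGraph (Fin n) | (g : ℕ∞) < G.egirth}.ncard ^ (r * r) := by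
  classical
  obtain ⟨ε, hε⟩ := exists_enumeration (Fin n) r
  let 𝒢 : Finset (SimpleGraph (Fin n)) := Finset.univ.filter fun G => (g : ℕ∞) < G.egirth
  have h𝒢 : {G : SimpleGraph (Fin n) | (g : ℕ∞) < G.egirth} = 𝒢 := by ext; simp [𝒢]
  let Φ : Hypergraph (Fin n) → Fin r × Fin r → SimpleGraph (Fin n) := fun H ij =>
    H.pairGraph fun e => s(ε e ij.1, ε e ij.2)
  have key := Set.ncard_le_ncard_of_injOn (s := forbLinear n r g)
    (t := (Fintype.piFinset fun _ : Fin r × Fin r => 𝒢 : Set (Fin r × Fin r → _))) Φ ?_ ?_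
    (Finset.finite_toSet _)
  · rwa [Set.ncard_coe_finset, Fintype.card_piFinset, Finset.prod_const, Finset.card_univ,
      Fintype.card_prod, Fintype.card_fin, ← Set.ncard_coe_finset, ← h𝒢] at key
  · rintro H ⟨-, hu, hH, hgirth⟩
    rw [Finset.mem_coe, Fintype.mem_piFinset]
    rintro ⟨i, j⟩
    refine Finset.mem_filter.2 ⟨Finset.mem_univ _, lt_egirth_pairGraph hH (fun e he x hx => ?_)
      hgirth⟩
    have hmem : ∀ k, ε e k ∈ e := fun k => (hε e (hu e he)).2.subset (Set.mem_range_self k)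
    rcases Sym2.mem_iff.1 hx with rfl | rfl
    · exact hmem i
    · exact hmem j
  · rintro H ⟨hV, hu, hH, hgirth⟩ H' ⟨hV', hu', hH', hgirth'⟩ hΦ
    have h3 : (3 : ℕ∞) ≤ g := by exact_mod_cast hg
    refine Hypergraph.ext (hV.trans hV'.symm) (Set.ext fun e => ?_)
    rw [mem_edgeSet_iff_forall_pairGraph_adj hr hu hH (h3.trans_lt hgirth) hε,
      mem_edgeSet_iff_forall_pairGraph_adj hr hu' hH' (h3.trans_lt hgirth') hε]
    refine and_congr_right fun _ => forall_congr' fun i => forall_congr' fun j => ?_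
    have := congrFun hΦ (i, j)
    simp only [Φ] at this
    rw [this]

theorem ncard_forbLinear_zero_le (r g : ℕ) (hr : 1 ≤ r) : (forbLinear 0 r g).ncard ≤ 1 := by
  rw [Set.ncard_le_one_iff_subsingleton]
  have hE : ∀ H ∈ forbLinear 0 r g, E(H) = ∅ := by
    rintro H ⟨-, hu, -⟩
    refine Set.eq_empty_of_forall_notMem fun e he => ?_
    have h := hu e he
    rw [Set.eq_empty_of_isEmpty e, Set.encard_empty] at h
    have : 0 = r := by exact_mod_cast h
    omega
  intro H hH H' hH'
  exact Hypergraph.ext (hH.1.trans hH'.1.symm) ((hE H hH).trans (hE H' hH').symm)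

theorem exists_ncard_forbLinear_le (r l : ℕ) (hr : 3 ≤ r) (hl : 2 ≤ l) :
    ∃ C : ℝ, 0 < C ∧ ∀ n : ℕ, ((forbLinear n r (2 * l)).ncard : ℝ) ≤
      (2 : ℝ) ^ (C * (n : ℝ) ^ (1 + 1 / (l : ℝ))) := by
  obtain ⟨C, hC, h⟩ := SimpleGraph.exists_card_egirth_gt_le l hl
  have hlog : 0 < Real.log 2 := Real.log_pos one_lt_two
  refine ⟨(r * r : ℕ) * C / Real.log 2, by positivity, fun n => ?_⟩
  rcases Nat.eq_zero_or_pos n with rfl | hn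
  · refine le_trans (b := 1) ?_ (Real.one_le_rpow one_le_two (by positivity))
    exact_mod_cast ncard_forbLinear_zero_le r (2 * l) (by omega)
  have : NeZero n := ⟨hn.ne'⟩
  calc ((forbLinear n r (2 * l)).ncard : ℝ)
      ≤ ({G : SimpleGraph (Fin n) | ((2 * l : ℕ) : ℕ∞) < G.egirth}.ncard : ℝ) ^ (r * r) := by
        exact_mod_cast ncard_forbLinear_le n r (2 * l) (by omega) (by omega)
    _ ≤ Real.exp (C * (n : ℝ) ^ (1 + 1 / (l : ℝ))) ^ (r * r) := by
        gcongr
        exact h n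
    _ = _ := by
        rw [← Real.exp_nat_mul, Real.rpow_def_of_pos two_pos]
        congr 1
        field_simp

theorem forbLinear_anti {n r l l' : ℕ} (h : l' ≤ l) : forbLinear n r l ⊆ forbLinear n r l' :=
  fun _ ⟨hV, hu, hH, hg⟩ => ⟨hV, hu, hH, lt_of_le_of_lt (by exact_mod_cast h) hg⟩

end Hypergraph

theorem theorem2 :
    (∀ r l : ℕ, 3 ≤ r → 4 ≤ l → ∃ C : ℝ, 0 < C ∧ ∀ n : ℕ,
      ((Hypergraph.forbLinear n r l).ncard : ℝ) ≤
        (2 : ℝ) ^ (C * (n : ℝ) ^ (1 + 1 / ((l / 2 : ℕ) : ℝ)))) ∧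
    (∀ r l : ℕ, 3 ≤ r → 2 ≤ l → ∃ C : ℝ, 0 < C ∧ ∀ n : ℕ,
      ((Hypergraph.forbLinear n r (2 * l)).ncard : ℝ) ≤
        (2 : ℝ) ^ (C * (n : ℝ) ^ (1 + 1 / (l : ℝ)))) := by
  refine ⟨fun r l hr hl => ?_, Hypergraph.exists_ncard_forbLinear_le⟩
  -- Since `2 * (l / 2) ≤ l`, the even case covers odd `l` too.
  obtain ⟨C, hC, h⟩ := Hypergraph.exists_ncard_forbLinear_le r (l / 2) hr (by omega)
  refine ⟨C, hC, fun n => le_trans ?_ (h n)⟩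
  exact_mod_cast Set.ncard_le_ncard (Hypergraph.forbLinear_anti (by omega)) (Set.toFinite _)
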